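/- Let $P$ be a finite poset. For a subposet $P'\subseteq P$ let $w(P')$ be its width, i.e. the minimal number of chains needed to cover $P'$. For integers $m,M\ge 0$ let $X(m,M)\subset\mathbb{R}^P$ be the set of points $(x_\alpha)_{\alpha\in P}$ with all $x_\alpha\ge 0$ and $$\sum_{\alpha\in P'}x_\alpha\le m\cdot w(P')+M\quad\text{for all } P'\subseteq P.$$ Then every $X(m,M)$ is a normal lattice polytope: it is the convex hull of finitely many points of $\mathbb{Z}^P$, and for every integer $k\ge 1$ every point of $kX(m,M)\cap\mathbb{Z}^P$ is a sum of $k$ points of $X(m,M)\cap\mathbb{Z}^P$. Moreover, for all integers $m_1,M_1,m_2,M_2\ge 0$ one has $$X(m_1,M_1)+X(m_2,M_2)=X(m_1+m_2,M_1+M_2),$$ where $+$ on the left is the Minkowski sum. -/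

import Mathlib

open scoped Pointwise

/-- The width of a (finite) subposet `Q`: the minimal number of chains needed to cover `Q`. -/
noncomputable def posetWidth {P : Type*} [PartialOrder P] (Q : Set P) : ℕ :=
  sInf {k : ℕ | ∃ C : Fin k → Set P, (∀ i, IsChain (· ≤ ·) (C i)) ∧ ⋃ i, C i = Q}

/-- The polytope `X(m, M)` of a finite poset `P`: the points of `ℝ^P` with nonnegative coordinates
whose sum of coordinates over any subposet `Q` is at most `m * w(Q) + M`. -/
def posetPolytope (P : Type*) [PartialOrder P] (m M : ℕ) : Set (P → ℝ) :=
  {x | (∀ a, 0 ≤ x a) ∧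
    ∀ Q : Finset P, ∑ a ∈ Q, x a ≤ (m : ℝ) * (posetWidth (Q : Set P) : ℝ) + (M : ℝ)}

/-- The set of integer points `ℤ^ι` inside `ℝ^ι`. -/
def integerPoints (ι : Type*) : Set (ι → ℝ) :=
  {x | ∀ i, ∃ n : ℤ, x i = (n : ℝ)}

/-- A lattice polytope in `ℝ^ι`: the convex hull of a finite set of integer points. -/
def IsLatticePolytope {ι : Type*} (X : Set (ι → ℝ)) : Prop :=
  ∃ V : Set (ι → ℝ), V.Finite ∧ V ⊆ integerPoints ι ∧ X = convexHull ℝ V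

/-- A normal lattice polytope: a lattice polytope `X` such that, for every `k ≥ 1`, each integer
point of the dilation `k X` is a sum of `k` integer points of `X`
(the integer decomposition property). -/
def IsNormalLatticePolytope {ι : Type*} (X : Set (ι → ℝ)) : Prop :=
  IsLatticePolytope X ∧
    ∀ k : ℕ, 1 ≤ k → ∀ x ∈ ((k : ℝ) • X) ∩ integerPoints ι,
      ∃ p : Fin k → (ι → ℝ), (∀ j, p j ∈ X ∩ integerPoints ι) ∧ x = ∑ j, p j

/-! The core is a weighted Greene theorem, `exists_antichain_decomposition`: every integer point of
`X(m, M)` is a sum of `m` antichain indicators and a nonnegative integer remainder of total at most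
`M`. Conversely such sums lie in `X(m, M)`, since a chain meets an antichain at most once.
Distributing the antichains and the remainder splits integer points of `X(m₁ + m₂, M₁ + M₂)`.
Iterating gives integer decomposition; rational approximation and then convexity pass to real
points.

Greene's theorem is proved by duality. The level sets `p a ≤ i < q a` of an integral potential are
antichains. At a potential maximizing `∑ (q - p)`, Hall's theorem yields a permutation along tight
constraints. Its non-fixed points form a set `S` covered by chains, and summing the tight equalities
bounds the remainder by `x(S) - m * w(S) ≤ M`. -/

/-! ### Chain covers and width. -/

section Width

variable {P : Type*} [PartialOrder P]

/-- If the elements of a finite set are linked by an injective partial map that strictly increases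
(`σ a = inl b` with `a < b`), then the set of non-fixed elements is covered by as many chains as
there are elements mapped outside. -/
theorem posetWidth_le_card_of_injective [Finite P] {D : Type*}
    (σ : P ⊕ D → P ⊕ D) (hσ : Function.Injective σ)
    (hlt : ∀ a b, σ (Sum.inl a) = Sum.inl b → a = b ∨ a < b)
    (T : Finset P) (hT : ∀ a, a ∈ T ↔ ∃ d, σ (Sum.inl a) = Sum.inr d) :
    posetWidth {a : P | σ (Sum.inl a) ≠ Sum.inl a} ≤ T.card := by
  set R : P → P → Prop := fun a b => σ (Sum.inl a) = Sum.inl b ∧ a < b with hR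
  have hreach : ∀ a, σ (Sum.inl a) ≠ Sum.inl a → ∃ t ∈ T, Relation.ReflTransGen R a t := by
    intro a
    induction a using (wellFounded_gt (α := P)).induction with
    | _ a ih =>
      intro ha
      rcases h : σ (Sum.inl a) with b | d
      · have hab : a < b := by
          rcases hlt a b h with rfl | h'
          · exact absurd h ha
          · exact h'
        have hb : σ (Sum.inl b) ≠ Sum.inl b := by
          intro hb
          have := hσ (h.trans hb.symm)
          exact hab.ne (Sum.inl_injective this)
        obtain ⟨t, ht, hbt⟩ := ih b hab hb
        exact ⟨t, ht, Relation.ReflTransGen.head ⟨h, hab⟩ hbt⟩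
      · exact ⟨a, (hT a).2 ⟨d, h⟩, Relation.ReflTransGen.refl⟩
  have hle : ∀ a b, Relation.ReflTransGen R a b → a ≤ b := by
    intro a b h
    induction h with
    | refl => exact le_rfl
    | tail _ h ih => exact ih.trans h.2.le
  -- Injectivity makes predecessors unique, so all elements leading to a given `t` lie on one
  -- backward path, hence in a chain.
  have huniq : Relator.RightUnique (Function.swap R) := by
    intro a b c h1 h2
    exact Sum.inl_injective (hσ (h1.1.trans h2.1.symm))
  refine Nat.sInf_le ⟨fun i => {a | σ (Sum.inl a) ≠ Sum.inl a ∧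
    Relation.ReflTransGen R a (T.equivFin.symm i)}, ?_, ?_⟩
  · rintro i a ⟨-, ha⟩ b ⟨-, hb⟩ -
    have ha' := Relation.reflTransGen_swap.2 ha
    have hb' := Relation.reflTransGen_swap.2 hb
    rcases Relation.ReflTransGen.total_of_right_unique huniq ha' hb' with h | h
    · exact Or.inr (hle _ _ (Relation.reflTransGen_swap.1 h))
    · exact Or.inl (hle _ _ (Relation.reflTransGen_swap.1 h))
  · ext a
    simp only [Set.mem_iUnion, Set.mem_ofPred_eq]
    constructor
    · rintro ⟨_, h, _⟩
      exact h
    · intro ha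
      obtain ⟨t, ht, hat⟩ := hreach a ha
      exact ⟨T.equivFin ⟨t, ht⟩, ha, by simpa using hat⟩

/-- The minimum in the definition of the width of a finite set is attained. -/
theorem exists_chain_cover (Q : Finset P) :
    ∃ C : Fin (posetWidth (Q : Set P)) → Set P,
      (∀ i, IsChain (· ≤ ·) (C i)) ∧ ⋃ i, C i = (Q : Set P) := by
  refine Nat.sInf_mem (s := {k : ℕ | ∃ C : Fin k → Set P,
    (∀ i, IsChain (· ≤ ·) (C i)) ∧ ⋃ i, C i = (Q : Set P)}) ⟨Q.card, ?_⟩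
  refine ⟨fun i => {(Q.equivFin.symm i : P)}, fun i => Set.subsingleton_singleton.isChain, ?_⟩
  ext a
  simp only [Set.mem_iUnion, Set.mem_singleton_iff, Finset.mem_coe]
  constructor
  · rintro ⟨i, rfl⟩
    exact (Q.equivFin.symm i).2
  · intro ha
    exact ⟨Q.equivFin ⟨a, ha⟩, by simp⟩

/-- An antichain contained in `Q` has at most `posetWidth Q` elements. -/
theorem card_le_posetWidth {A Q : Finset P} (hA : IsAntichain (· ≤ ·) (A : Set P)) (hAQ : A ⊆ Q) :
    A.card ≤ posetWidth (Q : Set P) := by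
  obtain ⟨C, hC, hCQ⟩ := exists_chain_cover Q
  have hmem : ∀ a ∈ A, ∃ i, a ∈ C i := by
    intro a ha
    have : a ∈ ⋃ i, C i := by
      rw [hCQ]
      exact hAQ ha
    simpa using this
  choose f hf using hmem
  have hinj : Function.Injective fun a : A => f a a.2 := by
    rintro ⟨a, ha⟩ ⟨b, hb⟩ hab
    have h1 := hf a ha
    have h2 := hf b hb
    dsimp only at hab
    rw [← hab] at h2
    by_contra hne
    have hne : a ≠ b := fun h => hne (Subtype.ext h)
    rcases hC _ h1 h2 hne with h | h
    · exact hA ha hb hne h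
    · exact hA hb ha hne.symm h
  simpa using Fintype.card_le_of_injective _ hinj

end Width

/-! ### Greene's theorem by potentials and matching. -/

section Greene

theorem sum_sub_ite {ι : Type*} [Fintype ι] [DecidableEq ι] (p q : ι → ℤ) (A N : Finset ι) :
    ∑ a, ((q a + if a ∈ A then 1 else 0) - (p a + if a ∈ N then 1 else 0)) =
      ∑ a, (q a - p a) + (A.card - N.card) := by
  simp only [Finset.sum_sub_distrib, Finset.sum_add_distrib, Finset.sum_boole,
    Finset.filter_univ_mem]
  ring

variable {P : Type*} [PartialOrder P] [Fintype P]

/-- Integral potentials for the problem of packing `m` antichains below the weight `x`. -/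
structure IsPotential (x : P → ℕ) (m : ℕ) (p q : P → ℤ) : Prop where
  nonneg : ∀ a, 0 ≤ p a
  le_top : ∀ a, q a ≤ m
  le_of_lt : ∀ a b, a < b → q a ≤ p b
  sub_le : ∀ a, q a - p a ≤ x a

/-- The objective is an integer bounded by the total of `x`, and the zero potential is admissible.
-/
theorem exists_max_potential (x : P → ℕ) (m : ℕ) :
    ∃ p q, IsPotential x m p q ∧
      ∀ p' q', IsPotential x m p' q' → ∑ a, (q' a - p' a) ≤ ∑ a, (q a - p a) := by
  obtain ⟨n, ⟨p, q, h, rfl⟩, hmax⟩ := Int.exists_greatest_of_bdd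
    (P := fun n => ∃ p q, IsPotential x m p q ∧ ∑ a, (q a - p a) = n)
    ⟨∑ a, (x a : ℤ), by
      rintro _ ⟨p, q, h, rfl⟩
      exact Finset.sum_le_sum fun a _ => h.sub_le a⟩
    ⟨_, 0, 0, ⟨by simp, by simp, by simp, by simp⟩, rfl⟩
  exact ⟨p, q, h, fun p' q' h' => hmax _ ⟨p', q', h', rfl⟩⟩

/-- The tightness relation of a potential, with dummy elements that may absorb the elements `a`
with `q a = m` and those with `p a = 0`. -/
def Tight (x : P → ℕ) (m : ℕ) (p q : P → ℤ) : P ⊕ P → P ⊕ P → Prop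
  | Sum.inl a, Sum.inl b => (a = b ∧ q a - p a = x a) ∨ (a < b ∧ q a = p b)
  | Sum.inl a, Sum.inr _ => q a = m
  | Sum.inr _, Sum.inl b => p b = 0
  | Sum.inr _, Sum.inr _ => True

variable [DecidableEq P]

/-- The elements of `A` with `q < m` have enough tight neighbours. -/
theorem card_le_of_lt_top {x : P → ℕ} {m : ℕ} {p q : P → ℤ} (h : IsPotential x m p q)
    (hmax : ∀ p' q', IsPotential x m p' q' → ∑ a, (q' a - p' a) ≤ ∑ a, (q a - p a))
    (A N : Finset P) (hA : ∀ a ∈ A, q a < m)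
    (hN : ∀ a ∈ A, ∀ b, Tight x m p q (Sum.inl a) (Sum.inl b) → b ∈ N) :
    A.card ≤ N.card := by
  -- Raising `q` on `A` and `p` on `N` changes the objective by `|A| - |N|`, which maximality forces
  -- to be at most zero.
  have key : IsPotential x m (fun a => p a + if a ∈ N then 1 else 0)
      (fun a => q a + if a ∈ A then 1 else 0) := by
    refine ⟨fun a => ?_, fun a => ?_, fun a b hab => ?_, fun a => ?_⟩
    · have := h.nonneg a
      split_ifs <;> omega
    · have := h.le_top a
      split_ifs with h1
      · have := hA a h1
        omega
      · omega
    · have := h.le_of_lt a b hab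
      by_cases h1 : a ∈ A
      · by_cases h2 : b ∈ N
        · simp only [h1, h2, if_true]
          omega
        · have : q a ≠ p b := fun he => h2 (hN a h1 b (Or.inr ⟨hab, he⟩))
          simp only [h1, h2, if_true, if_false]
          omega
      · simp only [h1, if_false]
        split_ifs <;> omega
    · have := h.sub_le a
      by_cases h1 : a ∈ A
      · by_cases h2 : a ∈ N
        · simp only [h1, h2, if_true]
          omega
        · have : q a - p a ≠ x a := fun he => h2 (hN a h1 a (Or.inl ⟨rfl, he⟩))
          simp only [h1, h2, if_true, if_false]
          omega
      · simp only [h1, if_false]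
        split_ifs <;> omega
  have := hmax _ _ key
  rw [sum_sub_ite] at this
  omega

/-- A set together with the zeros of `p` has enough tight neighbours. -/
theorem card_le_of_zeros {x : P → ℕ} {m : ℕ} {p q : P → ℤ} (h : IsPotential x m p q)
    (hmax : ∀ p' q', IsPotential x m p' q' → ∑ a, (q' a - p' a) ≤ ∑ a, (q a - p a))
    (A N : Finset P) (hp : ∀ b, p b = 0 → b ∈ N)
    (hN : ∀ a ∈ A, ∀ b, Tight x m p q (Sum.inl a) (Sum.inl b) → b ∈ N) :
    A.card ≤ N.card := by
  -- Same gain, now by lowering `q` off `A` and `p` off `N`; the zeros of `p` lie in `N`, so `p`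
  -- stays nonnegative.
  have key : IsPotential x m (fun a => (p a - 1) + if a ∈ N then 1 else 0)
      (fun a => (q a - 1) + if a ∈ A then 1 else 0) := by
    refine ⟨fun a => ?_, fun a => ?_, fun a b hab => ?_, fun a => ?_⟩
    · have := h.nonneg a
      split_ifs with h1
      · omega
      · have : p a ≠ 0 := fun he => h1 (hp a he)
        omega
    · have := h.le_top a
      split_ifs <;> omega
    · have := h.le_of_lt a b hab
      by_cases h1 : a ∈ A
      · by_cases h2 : b ∈ N
        · simp only [h1, h2, if_true]
          omega
        · have : q a ≠ p b := fun he => h2 (hN a h1 b (Or.inr ⟨hab, he⟩))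
          simp only [h1, h2, if_true, if_false]
          omega
      · simp only [h1, if_false]
        split_ifs <;> omega
    · have := h.sub_le a
      by_cases h1 : a ∈ A
      · by_cases h2 : a ∈ N
        · simp only [h1, h2, if_true]
          omega
        · have : q a - p a ≠ x a := fun he => h2 (hN a h1 a (Or.inl ⟨rfl, he⟩))
          simp only [h1, h2, if_true, if_false]
          omega
      · simp only [h1, if_false]
        split_ifs <;> omega
  have := hmax _ _ key
  rw [sum_sub_ite (fun a => p a - 1) (fun a => q a - 1)] at this
  simp only [sub_sub_sub_cancel_right] at this
  omega

/-- Hall's condition: a violating set would give a perturbation improving the maximal potential. -/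
theorem exists_injective_tight {x : P → ℕ} {m : ℕ} {p q : P → ℤ} (h : IsPotential x m p q)
    (hmax : ∀ p' q', IsPotential x m p' q' → ∑ a, (q' a - p' a) ≤ ∑ a, (q a - p a)) :
    ∃ σ : P ⊕ P → P ⊕ P, Function.Injective σ ∧ ∀ i, Tight x m p q i (σ i) := by
  classical
  let t : P ⊕ P → Finset (P ⊕ P) := fun i => Finset.univ.filter fun j => Tight x m p q i j
  have hall : ∀ s : Finset (P ⊕ P), s.card ≤ (s.biUnion t).card := by
    intro s
    set N := s.biUnion t with hNdef
    have hmemN : ∀ j, j ∈ N ↔ ∃ i ∈ s, Tight x m p q i j := by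
      intro j
      simp [hNdef, t]
    rw [← s.card_toLeft_add_card_toRight, ← N.card_toLeft_add_card_toRight]
    have hN : ∀ a ∈ s.toLeft, ∀ b, Tight x m p q (Sum.inl a) (Sum.inl b) → b ∈ N.toLeft := by
      intro a ha b hab
      rw [Finset.mem_toLeft] at ha ⊢
      exact (hmemN _).2 ⟨_, ha, hab⟩
    by_cases hr : s.toRight.Nonempty
    · obtain ⟨d, hd⟩ := hr
      rw [Finset.mem_toRight] at hd
      have h1 : N.toRight = Finset.univ := by
        ext e
        simp only [Finset.mem_toRight, Finset.mem_univ, iff_true]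
        exact (hmemN _).2 ⟨_, hd, trivial⟩
      have h2 := card_le_of_zeros h hmax s.toLeft N.toLeft (fun b hb => by
        rw [Finset.mem_toLeft]
        exact (hmemN _).2 ⟨_, hd, hb⟩) hN
      have h3 := Finset.card_le_univ s.toRight
      rw [h1, Finset.card_univ]
      omega
    · rw [Finset.not_nonempty_iff_eq_empty] at hr
      rw [hr, Finset.card_empty]
      by_cases ht : ∃ a ∈ s.toLeft, q a = m
      · obtain ⟨a, ha, haq⟩ := ht
        rw [Finset.mem_toLeft] at ha
        have h1 : N.toRight = Finset.univ := by
          ext e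
          simp only [Finset.mem_toRight, Finset.mem_univ, iff_true]
          exact (hmemN _).2 ⟨_, ha, haq⟩
        have h3 := Finset.card_le_univ s.toLeft
        rw [h1, Finset.card_univ]
        omega
      · push Not at ht
        have := card_le_of_lt_top h hmax s.toLeft N.toLeft
          (fun a ha => lt_of_le_of_ne (h.le_top a) (ht a ha)) hN
        omega
  obtain ⟨σ, hσ, hmem⟩ := (Finset.all_card_le_biUnion_card_iff_exists_injective t).1 hall
  exact ⟨σ, hσ, fun i => by simpa [t] using hmem i⟩

/-- Duality: some potential has value at least `x(P \ S) + m * posetWidth S` for some set `S`. -/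
theorem exists_potential_ge (x : P → ℕ) (m : ℕ) :
    ∃ p q, IsPotential x m p q ∧ ∃ S : Finset P,
      (∑ a, (x a : ℤ)) + m * posetWidth (S : Set P) ≤
        ∑ a, (q a - p a) + ∑ a ∈ S, (x a : ℤ) := by
  classical
  obtain ⟨p, q, h, hmax⟩ := exists_max_potential x m
  obtain ⟨σ, hσ, ht⟩ := exists_injective_tight h hmax
  refine ⟨p, q, h, Finset.univ.filter fun a => σ (Sum.inl a) ≠ Sum.inl a, ?_⟩
  set S : Finset P := Finset.univ.filter fun a => σ (Sum.inl a) ≠ Sum.inl a with hS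
  set T : Finset P := Finset.univ.filter fun a => ∃ d, σ (Sum.inl a) = Sum.inr d with hTdef
  have hw : posetWidth (S : Set P) ≤ T.card := by
    have := posetWidth_le_card_of_injective σ hσ (fun a b hab => by
      have := ht (Sum.inl a)
      rw [hab] at this
      exact this.imp And.left And.left) T (by simp [hTdef])
    simpa [hS] using this
  -- Complementary slackness: as `σ` permutes, the objective is `∑ (u i - v (σ i))`, where fixed
  -- elements give `x a`, exits to dummies give `m`, and all else gives zero.
  let u : P ⊕ P → ℤ := Sum.elim q 0
  let v : P ⊕ P → ℤ := Sum.elim p 0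
  have hbij : Function.Bijective σ := Finite.injective_iff_bijective.1 hσ
  have hsum : ∑ i, v (σ i) = ∑ i, v i := hbij.sum_comp v
  have hu : ∑ i, u i = ∑ a, q a := by simp [u]
  have hv : ∑ i, v i = ∑ a, p a := by simp [v]
  have hval : ∑ a, (q a - p a) = ∑ i, (u i - v (σ i)) := by
    rw [Finset.sum_sub_distrib, Finset.sum_sub_distrib, hsum, hu, hv]
  have hr : ∀ d : P, u (Sum.inr d) - v (σ (Sum.inr d)) = 0 := by
    intro d
    have := ht (Sum.inr d)
    rcases hd : σ (Sum.inr d) with b | e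
    · rw [hd] at this
      have hb : p b = 0 := this
      simp [u, v, hb]
    · simp [u, v]
  have hl : ∀ a : P, u (Sum.inl a) - v (σ (Sum.inl a)) =
      (if a ∈ S then 0 else (x a : ℤ)) + if a ∈ T then (m : ℤ) else 0 := by
    intro a
    have := ht (Sum.inl a)
    rcases ha : σ (Sum.inl a) with b | e
    · rw [ha] at this
      rcases this with ⟨rfl, h2⟩ | ⟨h1, h2⟩
      · simpa [u, v, hS, hTdef, ha] using h2
      · simp [u, v, hS, hTdef, ha, h1.ne', h2]
    · rw [ha] at this
      have hq : q a = m := this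
      simp [u, v, hS, hTdef, ha, hq]
  have hfin : ∑ a, (q a - p a) = ∑ a, (if a ∈ S then 0 else (x a : ℤ)) + T.card * m := by
    rw [hval, Fintype.sum_sum_type]
    simp only [hr, hl, Finset.sum_const_zero, add_zero, Finset.sum_add_distrib]
    simp [Finset.sum_ite_mem]
  have hsplit : ∑ a, (if a ∈ S then 0 else (x a : ℤ)) + ∑ a ∈ S, (x a : ℤ) = ∑ a, (x a : ℤ) := by
    rw [← Finset.univ_inter S, ← Finset.sum_ite_mem, ← Finset.sum_add_distrib]
    refine Finset.sum_congr rfl fun a _ => ?_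
    split_ifs <;> simp_all
  have hmw : (m : ℤ) * posetWidth (S : Set P) ≤ T.card * m := by
    rw [mul_comm]
    exact mul_le_mul_of_nonneg_right (by exact_mod_cast hw) (by positivity)
  linarith

/-- A weighted form of Greene's theorem: a weight `x` with `x(Q) ≤ m * posetWidth Q + M` for all
`Q` is the sum of `m` antichains and a remainder of total weight at most `M`. -/
theorem exists_antichain_decomposition (x : P → ℕ) (m M : ℕ)
    (hx : ∀ Q : Finset P, ∑ a ∈ Q, x a ≤ m * posetWidth (Q : Set P) + M) :
    ∃ (A : Fin m → Finset P) (r : P → ℕ), (∀ i, IsAntichain (· ≤ ·) (A i : Set P)) ∧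
      ∑ a, r a ≤ M ∧ ∀ a, x a = (∑ i, if a ∈ A i then 1 else 0) + r a := by
  classical
  obtain ⟨p, q, h, S, hS⟩ := exists_potential_ge x m
  let A : Fin m → Finset P := fun i => Finset.univ.filter fun a => p a ≤ i ∧ (i : ℤ) < q a
  have hcount : ∀ a, (∑ i, if a ∈ A i then 1 else 0) = (q a - p a).toNat := by
    intro a
    have h0 := h.nonneg a
    have hm := h.le_top a
    rw [Fin.sum_univ_eq_sum_range (fun i : ℕ => if a ∈ Finset.univ.filter
      (fun a => p a ≤ (i : ℤ) ∧ (i : ℤ) < q a) then 1 else 0) m, Finset.sum_boole]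
    have : (Finset.range m).filter (fun i : ℕ => a ∈ Finset.univ.filter
        (fun a => p a ≤ (i : ℤ) ∧ (i : ℤ) < q a)) = Finset.Ico (p a).toNat (q a).toNat := by
      ext i
      simp only [Finset.mem_filter, Finset.mem_univ, true_and, Finset.mem_range, Finset.mem_Ico]
      omega
    rw [this, Nat.card_Ico, Nat.cast_id]
    omega
  have hle : ∀ a, (q a - p a).toNat ≤ x a := by
    intro a
    have := h.sub_le a
    omega
  refine ⟨A, fun a => x a - (q a - p a).toNat, ?_, ?_, ?_⟩
  · intro i a ha b hb hne hab
    simp only [A, Finset.coe_filter, Finset.mem_univ, true_and, Set.mem_ofPred_eq] at ha hb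
    have := h.le_of_lt a b (lt_of_le_of_ne hab hne)
    omega
  -- Only an inequality, since `q a < p a` is allowed.
  · have h1 : ∑ a, ((x a - (q a - p a).toNat : ℕ) : ℤ) ≤ ∑ a, ((x a : ℤ) - (q a - p a)) := by
      refine Finset.sum_le_sum fun a _ => ?_
      have := hle a
      have := h.sub_le a
      rw [Nat.cast_sub (hle a)]
      omega
    rw [Finset.sum_sub_distrib] at h1
    have h2 : ((∑ a ∈ S, x a : ℕ) : ℤ) ≤ (m * posetWidth (S : Set P) + M : ℕ) := by
      exact_mod_cast hx S
    push_cast at h2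
    zify
    linarith
  · intro a
    rw [hcount]
    exact (Nat.add_sub_cancel' (hle a)).symm

end Greene

/-- Below a weight of total at least `n` there is a weight of total exactly `n`. -/
theorem exists_le_sum_eq {ι : Type*} [Fintype ι] (r : ι → ℕ) (n : ℕ) (hn : n ≤ ∑ a, r a) :
    ∃ s : ι → ℕ, s ≤ r ∧ ∑ a, s a = n := by
  classical
  induction n with
  | zero => exact ⟨0, fun _ => Nat.zero_le _, by simp⟩
  | succ n ih =>
    obtain ⟨s, hs, hsum⟩ := ih (by omega)
    obtain ⟨a, -, ha⟩ := Finset.exists_lt_of_sum_lt (s := Finset.univ) (f := s) (g := r) (by omega)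
    refine ⟨s + Pi.single a 1, fun b => ?_, ?_⟩
    · by_cases hb : b = a
      · subst hb
        simpa using ha
      · simpa [hb] using hs b
    · simp [Finset.sum_add_distrib, hsum]

/-! ### Integer decomposition, convex hulls and Minkowski sums. -/

section Polytope

variable {P : Type*} [PartialOrder P]

theorem mem_posetPolytope_of_antichains [Fintype P] [DecidableEq P] {m M : ℕ}
    (A : Fin m → Finset P) (r : P → ℕ) (hA : ∀ i, IsAntichain (· ≤ ·) (A i : Set P))
    (hr : ∑ a, r a ≤ M) :
    (fun a => (((∑ i, if a ∈ A i then 1 else 0) + r a : ℕ) : ℝ)) ∈ posetPolytope P m M := by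
  refine ⟨fun a => Nat.cast_nonneg _, fun Q => ?_⟩
  have h1 : ∑ a ∈ Q, ∑ i, (if a ∈ A i then 1 else 0) ≤ m * posetWidth (Q : Set P) := by
    rw [Finset.sum_comm]
    have : ∀ i, ∑ a ∈ Q, (if a ∈ A i then 1 else 0) ≤ posetWidth (Q : Set P) := by
      intro i
      rw [← Finset.card_filter]
      refine card_le_posetWidth ((hA i).subset ?_) (Finset.filter_subset _ _)
      intro a ha
      exact (Finset.mem_filter.1 ha).2
    simpa using Finset.sum_le_sum fun i (_ : i ∈ Finset.univ) => this i
  have h2 : ∑ a ∈ Q, r a ≤ M :=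
    (Finset.sum_le_sum_of_subset (Finset.subset_univ Q)).trans hr
  rw [← Nat.cast_sum, Finset.sum_add_distrib]
  exact_mod_cast add_le_add h1 h2

theorem exists_nat_of_mem {m M : ℕ} {x : P → ℝ} (hx : x ∈ posetPolytope P m M)
    (hi : x ∈ integerPoints P) : ∃ y : P → ℕ, x = fun a => (y a : ℝ) := by
  choose n hn using hi
  refine ⟨fun a => (n a).toNat, funext fun a => ?_⟩
  have h0 := hx.1 a
  rw [hn a] at h0 ⊢
  have : 0 ≤ n a := by exact_mod_cast h0
  exact_mod_cast (Int.toNat_of_nonneg this).symm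

theorem natCast_mem_integerPoints {ι : Type*} (y : ι → ℕ) :
    (fun a => (y a : ℝ)) ∈ integerPoints ι :=
  fun a => ⟨y a, by simp⟩

theorem zero_mem_posetPolytope (m M : ℕ) : (0 : P → ℝ) ∈ posetPolytope P m M :=
  ⟨fun _ => le_rfl, fun Q => by simp only [Pi.zero_apply, Finset.sum_const_zero]; positivity⟩

/-- Integer points of `X(m₁ + m₂, M₁ + M₂)` split into integer points of the two summands. -/
theorem exists_add_of_mem_integerPoints [Finite P] {m₁ M₁ m₂ M₂ : ℕ} {x : P → ℝ}
    (hx : x ∈ posetPolytope P (m₁ + m₂) (M₁ + M₂)) (hi : x ∈ integerPoints P) :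
    ∃ y ∈ posetPolytope P m₁ M₁ ∩ integerPoints P,
      ∃ z ∈ posetPolytope P m₂ M₂ ∩ integerPoints P, x = y + z := by
  classical
  obtain ⟨_⟩ := nonempty_fintype P
  obtain ⟨n, rfl⟩ := exists_nat_of_mem hx hi
  obtain ⟨A, r, hA, hr, hn⟩ := exists_antichain_decomposition n (m₁ + m₂) (M₁ + M₂)
    (fun Q => by
      have := hx.2 Q
      dsimp only at this
      exact_mod_cast this)
  obtain ⟨s, hs, hsum⟩ := exists_le_sum_eq r (min M₁ (∑ a, r a)) (min_le_right _ _)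
  have hrs : ∑ a, (r a - s a) ≤ M₂ := by
    have : ∑ a, (r a - s a) + ∑ a, s a = ∑ a, r a := by
      rw [← Finset.sum_add_distrib]
      exact Finset.sum_congr rfl fun a _ => Nat.sub_add_cancel (hs a)
    omega
  refine ⟨_, ⟨mem_posetPolytope_of_antichains (fun i => A (Fin.castAdd m₂ i)) s (fun i => hA _)
    (by omega), natCast_mem_integerPoints _⟩, _, ⟨mem_posetPolytope_of_antichains
    (fun i => A (Fin.natAdd m₁ i)) (fun a => r a - s a) (fun i => hA _) hrs,
    natCast_mem_integerPoints _⟩, ?_⟩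
  funext a
  rw [Pi.add_apply, ← Nat.cast_add, hn a, Fin.sum_univ_add]
  have : s a ≤ r a := hs a
  congr 1
  omega

/-- Integer points of `X(k m, k M)` are sums of `k` integer points of `X(m, M)`. -/
theorem exists_sum_of_mem_integerPoints [Finite P] {m M : ℕ} (k : ℕ) {x : P → ℝ}
    (hx : x ∈ posetPolytope P (k * m) (k * M)) (hi : x ∈ integerPoints P) :
    ∃ p : Fin k → P → ℝ, (∀ j, p j ∈ posetPolytope P m M ∩ integerPoints P) ∧ x = ∑ j, p j := by
  induction k generalizing x with
  | zero =>
    -- `X(0, 0)` is the origin, the empty sum.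
    refine ⟨Fin.elim0, fun j => j.elim0, ?_⟩
    funext a
    have h0 := hx.1 a
    have h1 := hx.2 {a}
    simp only [Finset.sum_singleton, zero_mul, Nat.cast_zero, add_zero] at h1
    simpa using le_antisymm h1 h0
  | succ k ih =>
    rw [Nat.succ_mul, Nat.succ_mul] at hx
    obtain ⟨y, hy, z, hz, rfl⟩ := exists_add_of_mem_integerPoints hx hi
    obtain ⟨p, hp, rfl⟩ := ih hy.1 hy.2
    refine ⟨Fin.snoc p z, fun j => ?_, ?_⟩
    · refine Fin.lastCases ?_ (fun j => ?_) j
      · simpa using hz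
      · simpa using hp j
    · simp [Fin.sum_univ_castSucc]

theorem smul_mem_posetPolytope {m M : ℕ} (k : ℕ) {x : P → ℝ} (hx : x ∈ posetPolytope P m M) :
    (k : ℝ) • x ∈ posetPolytope P (k * m) (k * M) := by
  refine ⟨fun a => mul_nonneg (Nat.cast_nonneg k) (hx.1 a), fun Q => ?_⟩
  have := mul_le_mul_of_nonneg_left (hx.2 Q) (Nat.cast_nonneg (α := ℝ) k)
  simp only [Pi.smul_apply, smul_eq_mul, ← Finset.mul_sum]
  push_cast
  linarith

theorem posetPolytope_downward {m M : ℕ} {x y : P → ℝ} (hx : x ∈ posetPolytope P m M)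
    (hy : ∀ a, 0 ≤ y a) (hyx : y ≤ x) : y ∈ posetPolytope P m M :=
  ⟨hy, fun Q => (Finset.sum_le_sum fun a _ => hyx a).trans (hx.2 Q)⟩

theorem convex_posetPolytope (m M : ℕ) : Convex ℝ (posetPolytope P m M) := by
  intro x hx y hy s t hs ht hst
  refine ⟨fun a => add_nonneg (mul_nonneg hs (hx.1 a)) (mul_nonneg ht (hy.1 a)), fun Q => ?_⟩
  have h1 := mul_le_mul_of_nonneg_left (hx.2 Q) hs
  have h2 := mul_le_mul_of_nonneg_left (hy.2 Q) ht
  simp only [Pi.add_apply, Pi.smul_apply, smul_eq_mul, Finset.sum_add_distrib, ← Finset.mul_sum]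
  refine (add_le_add h1 h2).trans_eq ?_
  rw [← add_mul, hst, one_mul]

theorem finite_integerPoints_posetPolytope [Finite P] (m M : ℕ) :
    (posetPolytope P m M ∩ integerPoints P).Finite := by
  classical
  obtain ⟨_⟩ := nonempty_fintype P
  let b : P → ℕ := fun a => m * posetWidth (({a} : Finset P) : Set P) + M
  refine ((Set.finite_Icc 0 b).image fun y a => (y a : ℝ)).subset ?_
  rintro x ⟨hx, hi⟩
  obtain ⟨y, rfl⟩ := exists_nat_of_mem hx hi
  refine ⟨y, ⟨fun a => Nat.zero_le _, fun a => ?_⟩, rfl⟩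
  have := hx.2 {a}
  rw [Finset.sum_singleton] at this
  change y a ≤ m * posetWidth (({a} : Finset P) : Set P) + M
  exact_mod_cast this

/-- Rounding `x` down to multiples of `1/n` stays in the polytope, and the rounded point is the
average of `n` integer points of it. The hull of finitely many points is closed, so the limit `x`
lies in it. -/
theorem posetPolytope_eq_convexHull [Finite P] (m M : ℕ) :
    posetPolytope P m M = convexHull ℝ (posetPolytope P m M ∩ integerPoints P) := by
  refine subset_antisymm (fun x hx => ?_)
    (convexHull_min Set.inter_subset_left (convex_posetPolytope m M))
  have hclosed : IsClosed (convexHull ℝ (posetPolytope P m M ∩ integerPoints P)) :=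
    (finite_integerPoints_posetPolytope m M).isClosed_convexHull ℝ
  let y : ℕ → P → ℝ := fun n a => (⌊x a * n⌋₊ : ℝ) / n
  have hy : Filter.Tendsto y Filter.atTop (nhds x) := by
    rw [tendsto_pi_nhds]
    intro a
    exact (tendsto_nat_floor_mul_div_atTop (hx.1 a)).comp tendsto_natCast_atTop_atTop
  refine hclosed.mem_of_tendsto hy ?_
  filter_upwards [Filter.eventually_ge_atTop 1] with n hn
  have hn0 : (0 : ℝ) < n := by exact_mod_cast hn
  have hyX : y n ∈ posetPolytope P m M := by
    refine posetPolytope_downward hx (fun a => by positivity) fun a => ?_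
    rw [div_le_iff₀ hn0]
    exact Nat.floor_le (mul_nonneg (hx.1 a) hn0.le)
  have hint : (n : ℝ) • y n ∈ integerPoints P := by
    refine fun a => ⟨⌊x a * n⌋₊, ?_⟩
    simp only [Pi.smul_apply, smul_eq_mul, y, Int.cast_natCast]
    field_simp
  obtain ⟨p, hp, hsum⟩ := exists_sum_of_mem_integerPoints n (smul_mem_posetPolytope n hyX) hint
  have : y n = ∑ j : Fin n, (n : ℝ)⁻¹ • p j := by
    rw [← Finset.smul_sum, ← hsum, smul_smul, inv_mul_cancel₀ hn0.ne', one_smul]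
  rw [this]
  refine (convex_convexHull ℝ _).sum_mem (fun _ _ => by positivity) ?_
    fun j _ => subset_convexHull ℝ _ (hp j)
  simp [hn0.ne']

theorem isNormalLatticePolytope_posetPolytope [Finite P] (m M : ℕ) :
    IsNormalLatticePolytope (posetPolytope P m M) := by
  refine ⟨⟨_, finite_integerPoints_posetPolytope m M, Set.inter_subset_right,
    posetPolytope_eq_convexHull m M⟩, ?_⟩
  rintro k - _ ⟨⟨x, hx, rfl⟩, hi⟩
  exact exists_sum_of_mem_integerPoints k (smul_mem_posetPolytope k hx) hi

theorem posetPolytope_add [Finite P] (m₁ M₁ m₂ M₂ : ℕ) :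
    posetPolytope P m₁ M₁ + posetPolytope P m₂ M₂ = posetPolytope P (m₁ + m₂) (M₁ + M₂) := by
  apply subset_antisymm
  · rintro _ ⟨x, hx, y, hy, rfl⟩
    refine ⟨fun a => add_nonneg (hx.1 a) (hy.1 a), fun Q => ?_⟩
    have h1 := hx.2 Q
    have h2 := hy.2 Q
    simp only [Pi.add_apply, Finset.sum_add_distrib]
    push_cast
    linarith
  -- The Minkowski sum is convex, so only integer points need splitting.
  · rw [posetPolytope_eq_convexHull (m₁ + m₂)]
    refine convexHull_min ?_ ((convex_posetPolytope m₁ M₁).add (convex_posetPolytope m₂ M₂))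
    rintro x ⟨hx, hi⟩
    obtain ⟨y, hy, z, hz, rfl⟩ := exists_add_of_mem_integerPoints hx hi
    exact Set.add_mem_add hy.1 hz.1

end Polytope

theorem corollary1p4 (P : Type*) [PartialOrder P] [Finite P] :
    (∀ m M : ℕ, IsNormalLatticePolytope (posetPolytope P m M)) ∧
      ∀ m₁ M₁ m₂ M₂ : ℕ,
        posetPolytope P m₁ M₁ + posetPolytope P m₂ M₂ =
          posetPolytope P (m₁ + m₂) (M₁ + M₂) :=
  ⟨isNormalLatticePolytope_posetPolytope, posetPolytope_add⟩
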